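/- A signed Gauss diagram $D$ with $n$ numbered oriented circles has finitely many signed arrows whose endpoints are distinct points of the circles; the Gauss diagram of a link diagram has one arrow for each crossing, directed from the over-crossing to the under-crossing and carrying the local writhe as its sign. Gauss diagrams up to the Reidemeister moves R1, R2, R3 represent virtual links. The link represented by $D$ is called classical if $D$ is related by Reidemeister moves to the Gauss diagram of a planar link diagram, i.e. of a regular projection of an oriented smooth link in $\mathbb{R}^3$. The virtual linking number $lk_{j/k}$ is the sum of the signs of the crossings at which component $j$ crosses over component $k$. The forbidden moves exchange two consecutive arrow endpoints (two tails, two heads, or a tail and a head) belonging to different arrows. A forbidden quiver of the link is obtained by using Reidemeister and forbidden moves to reach a diagram in which no arrow joins a circle to itself and all arrows from one circle to another, in the same direction, have the same sign, and then shrinking the circles to vertices $1,\dots,n$. The forbidden matrix is the $n\times n$ integer matrix whose entry in row $j$ and column $k$ is the integer label of the arrows from $j$ to $k$ (the number of these arrows times their common sign, and $0$ if there are none). **Corollary.** Let $L$ be a classical link with $n$ components, represented by a Gauss diagram $D$. Then $lk_{j/k}=lk_{k/j}$, computed in $D$, for all components $j$ and $k$. Moreover, for the given numbering of the components, the forbidden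 matrix of $L$ exists, does not depend on the choices made in the reduction, and is symmetric. -/

import Mathlib

/-- A signed Gauss diagram with `n` (oriented, numbered) circles. The endpoints of the arrows are the
pairs `(a, b)`, where `b = true` is the tail of `a` (the over-crossing) and `b = false` is its head
(the under-crossing). `next` sends an endpoint to the one that follows it on its circle and `comp`
names that circle. A circle that is not a value of `comp` carries no endpoint. -/
structure GaussDiagram (n : ℕ) where
  Arrow : Type
  [fintypeArrow : Fintype Arrow]
  sign : Arrow → ℤˣ
  next : Equiv.Perm (Arrow × Bool)
  comp : Arrow × Bool → Fin n
  comp_eq_iff : ∀ e f, comp e = comp f ↔ next.SameCycle e f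

namespace GaussDiagram

attribute [instance] GaussDiagram.fintypeArrow

variable {n : ℕ}

/-- The tail of an arrow (over-crossing). -/
def tail (D : GaussDiagram n) (a : D.Arrow) : D.Arrow × Bool := (a, true)

/-- The head of an arrow (under-crossing). -/
def head (D : GaussDiagram n) (a : D.Arrow) : D.Arrow × Bool := (a, false)

open Classical in
/-- The virtual linking number `lk_{j/k}`: the sum of the signs of the crossings at which
component `j` crosses over component `k`. -/
noncomputable def lk (D : GaussDiagram n) (j k : Fin n) : ℤ :=
  ∑ a : D.Arrow, if D.comp (D.tail a) = j ∧ D.comp (D.head a) = k then (D.sign a : ℤ) else 0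

/-- `e` and `f` are neighbours on a circle; `δ = 1` if `e` is directly followed by `f`, and `δ = -1`
if `f` is directly followed by `e`. -/
def Adj (D : GaussDiagram n) (e f : D.Arrow × Bool) (δ : ℤˣ) : Prop :=
  (δ = 1 ∧ D.next e = f) ∨ (δ = -1 ∧ D.next f = e)

/-- Rearrange the endpoints: `σ e` takes the place of `e`. -/
abbrev rearrange (D : GaussDiagram n) (σ : Equiv.Perm (D.Arrow × Bool)) : GaussDiagram n where
  Arrow := D.Arrow
  sign := D.sign
  next := σ * D.next * σ⁻¹
  comp := fun e => D.comp (σ⁻¹ e)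
  comp_eq_iff := fun e f => by
    rw [D.comp_eq_iff, Equiv.Perm.sameCycle_conj]

open Classical in
/-- Let the endpoints `e` and `f` trade places. -/
noncomputable abbrev exchange (D : GaussDiagram n) (e f : D.Arrow × Bool) : GaussDiagram n :=
  D.rearrange (Equiv.swap e f)

/-- `D'` is obtained from `D` by erasing the arrows outside the range of `f`: signs and circles of
the remaining arrows are kept, and the successor of an endpoint in `D'` is the first remaining
endpoint that follows it in `D`. -/
structure IsErasure (D D' : GaussDiagram n) (f : D'.Arrow ↪ D.Arrow) : Prop where
  sign_eq : ∀ a, D'.sign a = D.sign (f a)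
  comp_eq : ∀ e, D'.comp e = D.comp (Prod.map f id e)
  next_eq : ∀ e, ∃ m : ℕ, (D.next)^[m + 1] (Prod.map f id e) = Prod.map f id (D'.next e) ∧
    ∀ l < m, ((D.next)^[l + 1] (Prod.map f id e)).1 ∉ Set.range f

open Classical in
/-- The Reidemeister moves on signed Gauss diagrams (each to be used in both directions), and the
renaming of arrows. -/
inductive ReidemeisterMove : GaussDiagram n → GaussDiagram n → Prop
  | rename {D D' : GaussDiagram n} (f : D'.Arrow ↪ D.Arrow) (hf : D.IsErasure D' f)
      (hr : Set.range f = Set.univ) : ReidemeisterMove D D'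
  /-- Remove an arrow whose tail and head are neighbours. -/
  | r1 {D D' : GaussDiagram n} (f : D'.Arrow ↪ D.Arrow) (hf : D.IsErasure D' f)
      (a : D.Arrow) (hr : Set.range f = {a}ᶜ) (p : ℤˣ)
      (ha : D.Adj (D.tail a) (D.head a) p) : ReidemeisterMove D D'
  /-- Remove two arrows of opposite signs whose tails are neighbours and whose heads are
  neighbours. -/
  | r2 {D D' : GaussDiagram n} (f : D'.Arrow ↪ D.Arrow) (hf : D.IsErasure D' f)
      (a b : D.Arrow) (hab : a ≠ b) (hr : Set.range f = {a, b}ᶜ) (p q : ℤˣ)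
      (ho : D.Adj (D.tail a) (D.tail b) p) (hu : D.Adj (D.head a) (D.head b) q)
      (hs : D.sign a = -D.sign b) : ReidemeisterMove D D'
  /-- Slide a strand past a crossing: `x` is the crossing of the top strand over the middle one, `y`
  that of the top strand over the bottom one, `z` that of the middle strand over the bottom one.
  The conditions on the signs say that the three strands bound a triangle in the oriented plane
  with the given directions. -/
  | r3 {D : GaussDiagram n} (x y z : D.Arrow) (hxy : x ≠ y) (hxz : x ≠ z) (hyz : y ≠ z)
      (p q r : ℤˣ)
      (ht : D.Adj (D.tail x) (D.tail y) p) (hm : D.Adj (D.head x) (D.tail z) q)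
      (hb : D.Adj (D.head y) (D.head z) r)
      (h₁ : D.sign x * D.sign y = q * r) (h₂ : D.sign y * D.sign z = p * q) :
      ReidemeisterMove D
        (D.rearrange (Equiv.swap (D.tail x) (D.tail y) * Equiv.swap (D.head x) (D.tail z) *
          Equiv.swap (D.head y) (D.head z)))

/-- The forbidden moves: two consecutive endpoints of different arrows trade places. -/
inductive ForbiddenMove : GaussDiagram n → GaussDiagram n → Prop
  /-- Move a tail past a tail. -/
  | tail_tail {D : GaussDiagram n} (a b : D.Arrow) (hab : a ≠ b)
      (h : D.next (D.tail a) = D.tail b) : ForbiddenMove D (D.exchange (D.tail a) (D.tail b))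
  /-- Move a head past a head. -/
  | head_head {D : GaussDiagram n} (a b : D.Arrow) (hab : a ≠ b)
      (h : D.next (D.head a) = D.head b) : ForbiddenMove D (D.exchange (D.head a) (D.head b))
  /-- Move a tail forward past a head. -/
  | tail_head {D : GaussDiagram n} (a b : D.Arrow) (hab : a ≠ b)
      (h : D.next (D.tail a) = D.head b) : ForbiddenMove D (D.exchange (D.tail a) (D.head b))
  /-- Move a head forward past a tail. -/
  | head_tail {D : GaussDiagram n} (a b : D.Arrow) (hab : a ≠ b)
      (h : D.next (D.head a) = D.tail b) : ForbiddenMove D (D.exchange (D.head a) (D.tail b))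

/-- Two Gauss diagrams represent the same virtual link. -/
def ReidemeisterEquiv (D D' : GaussDiagram n) : Prop :=
  Relation.EqvGen ReidemeisterMove D D'

/-- Two Gauss diagrams represent the same fused link. -/
def FusedEquiv (D D' : GaussDiagram n) : Prop :=
  Relation.EqvGen (fun E E' => ReidemeisterMove E E' ∨ ForbiddenMove E E') D D'

/-- A reduced diagram: no arrow joins a circle to itself, and arrows from one circle to another
(in the same direction) all have the same sign. -/
structure IsReduced (D : GaussDiagram n) : Prop where
  no_self : ∀ a, D.comp (D.tail a) ≠ D.comp (D.head a)
  same_sign : ∀ a b, D.comp (D.tail a) = D.comp (D.tail b) →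
    D.comp (D.head a) = D.comp (D.head b) → D.sign a = D.sign b

end GaussDiagram

/-- A finite quiver on the vertices `0, …, n - 1` with signed arrows. -/
structure SignedQuiver (n : ℕ) where
  Edge : Type
  [fintypeEdge : Fintype Edge]
  source : Edge → Fin n
  target : Edge → Fin n
  sign : Edge → ℤˣ

attribute [instance] SignedQuiver.fintypeEdge

open Classical in
/-- The matrix whose `(j, k)` entry is the integer label of the arrows from `j` to `k`; `m` parallel
arrows of sign `ε` have the label `ε m`. -/
noncomputable def SignedQuiver.labelMatrix {n : ℕ} (Q : SignedQuiver n) :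
    Matrix (Fin n) (Fin n) ℤ :=
  Matrix.of fun j k => ∑ a : Q.Edge, if Q.source a = j ∧ Q.target a = k then (Q.sign a : ℤ) else 0

namespace GaussDiagram

variable {n : ℕ}

/-- Shrink the circles to vertices. -/
def shrink (D : GaussDiagram n) : SignedQuiver n where
  Edge := D.Arrow
  source := fun a => D.comp (D.tail a)
  target := fun a => D.comp (D.head a)
  sign := D.sign

/-- `Q` is a forbidden quiver of the link represented by `D`: it arises by reducing `D` with
Reidemeister and forbidden moves and then shrinking the circles to vertices. -/
def IsForbiddenQuiver (D : GaussDiagram n) (Q : SignedQuiver n) : Prop :=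
  ∃ D' : GaussDiagram n, D.FusedEquiv D' ∧ D'.IsReduced ∧ Q = D'.shrink

/-- `M` is the matrix of labels of a forbidden quiver of the link represented by `D`. -/
def IsForbiddenMatrix (D : GaussDiagram n) (M : Matrix (Fin n) (Fin n) ℤ) : Prop :=
  ∃ Q : SignedQuiver n, D.IsForbiddenQuiver Q ∧ M = Q.labelMatrix

end GaussDiagram

open scoped ContDiff in
/-- An oriented link of `n` numbered components in `ℝ³`: disjoint smoothly embedded closed curves,
parametrised by `ℝ/ℤ`. -/
structure SpaceLink (n : ℕ) where
  curve : Fin n → ℝ → EuclideanSpace ℝ (Fin 3)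
  smooth : ∀ i, ContDiff ℝ ∞ (curve i)
  periodic : ∀ i, Function.Periodic (curve i) 1
  regular : ∀ i t, deriv (curve i) t ≠ 0
  embedded : ∀ i j s t, curve i s = curve j t → i = j ∧ ∃ m : ℤ, s - t = m

namespace SpaceLink

variable {n : ℕ}

/-- The projection of the link to the plane of the first two coordinates. -/
noncomputable def shadow (K : SpaceLink n) (i : Fin n) (t : ℝ) : ℝ × ℝ :=
  (K.curve i t 0, K.curve i t 1)

/-- The height above the plane. -/
noncomputable def height (K : SpaceLink n) (i : Fin n) (t : ℝ) : ℝ := K.curve i t 2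

/-- The determinant of the projected velocities of component `i` at `s` and component `j` at `t`. -/
noncomputable def velocityDet (K : SpaceLink n) (i : Fin n) (s : ℝ) (j : Fin n) (t : ℝ) : ℝ :=
  deriv (K.curve i) s 0 * deriv (K.curve j) t 1 - deriv (K.curve i) s 1 * deriv (K.curve j) t 0

/-- Component `i`, at time `s`, crosses over component `j`, at time `t`. -/
def CrossesOver (K : SpaceLink n) (i : Fin n) (s : ℝ) (j : Fin n) (t : ℝ) : Prop :=
  K.shadow i s = K.shadow j t ∧ K.height j t < K.height i s

/-- The projection is a link diagram: an immersion whose only multiple points are transverse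
double points. -/
structure IsRegularProjection (K : SpaceLink n) : Prop where
  immersed : ∀ i t, ¬ (deriv (K.curve i) t 0 = 0 ∧ deriv (K.curve i) t 1 = 0)
  transverse : ∀ i s j t, K.CrossesOver i s j t → K.velocityDet i s j t ≠ 0
  no_triple : ∀ i j k, ∀ r ∈ Set.Ico (0 : ℝ) 1, ∀ s ∈ Set.Ico (0 : ℝ) 1, ∀ t ∈ Set.Ico (0 : ℝ) 1,
    K.shadow i r = K.shadow j s → K.shadow j s = K.shadow k t →
    (i = j ∧ r = s) ∨ (j = k ∧ s = t) ∨ (i = k ∧ r = t)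

/-- Going from `a` in the positive direction around the circle `ℝ/ℤ = [0, 1)`, one meets `b`
strictly before `c` (the three being distinct). -/
def CyclicBetween (a b c : ℝ) : Prop :=
  (a < b ∧ b < c) ∨ (b < c ∧ c < a) ∨ (c < a ∧ a < b)

/-- `D` is the signed Gauss diagram of the link diagram given by the projection of `K`; the endpoint
`e` lies on the circle `D.comp e` at the point `pos e` of `[0, 1)`. The arrows are the crossings,
directed from the over- to the under-crossing, endpoints follow each other on the circles as they do
on the curves, and the sign is the local writhe: positive when the pair (velocity of the over-strand,
velocity of the under-strand) is positively oriented. -/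
def HasGaussDiagram (K : SpaceLink n) (D : GaussDiagram n) : Prop :=
  ∃ pos : D.Arrow × Bool → ℝ,
    (∀ e, pos e ∈ Set.Ico (0 : ℝ) 1) ∧
    (∀ e f, D.comp e = D.comp f → pos e = pos f → e = f) ∧
    (∀ i j, ∀ s ∈ Set.Ico (0 : ℝ) 1, ∀ t ∈ Set.Ico (0 : ℝ) 1,
      K.CrossesOver i s j t ↔
        ∃ a, D.comp (D.tail a) = i ∧ pos (D.tail a) = s ∧
          D.comp (D.head a) = j ∧ pos (D.head a) = t) ∧
    (∀ e f, D.comp e = D.comp f → ¬ CyclicBetween (pos e) (pos f) (pos (D.next e))) ∧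
    (∀ a, 0 < ((D.sign a : ℤ) : ℝ) *
      K.velocityDet (D.comp (D.tail a)) (pos (D.tail a)) (D.comp (D.head a)) (pos (D.head a)))

end SpaceLink

/-- The virtual link represented by `D` is classical: up to Reidemeister moves, `D` is the Gauss
diagram of a planar link diagram, namely of a regular projection of a link in `ℝ³`. -/
def GaussDiagram.IsClassical {n : ℕ} (D : GaussDiagram n) : Prop :=
  ∃ (K : SpaceLink n) (D₀ : GaussDiagram n),
    K.IsRegularProjection ∧ K.HasGaussDiagram D₀ ∧ D.ReidemeisterEquiv D₀

/-! For `j ≠ k` the number `lk j k` is unchanged by all the moves: R1 erases an arrow from a circle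
to itself, R2 erases two parallel arrows of opposite signs, and R3 and the forbidden moves only
permute endpoints within circles (`ReidemeisterMove.lk_eq`, `ForbiddenMove.lk_eq`). In a reduced
diagram the labels are the numbers `lk j k`, with zero diagonal, so every forbidden matrix has the
entries given by `IsForbiddenMatrix.apply_eq`. One exists because forbidden moves slide endpoints
along a circle until R1 or R2 removes arrows; the number of arrows drops until the diagram is
reduced (`exists_fusedEquiv_isReduced`).

Symmetry comes from planar topology. In the projection of a space link, `lk j k - lk k j` is the
algebraic intersection number of the shadows of components `j` and `k`, since exchanging over and
under reverses the sign of the velocity determinant. Closed plane curves `a`, `b` have intersection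
number zero (`sum_sign_eq_zero`): it is the degree of `(s, t) ↦ a s - b t` from the torus to the
plane, up to sign. Integrating the pull-back of a bump form of mass one near the origin gives the
signed count of zeros (`exists_forall_setIntegral_comp_mul_det`), and gives zero because the
pull-back is exact (`integral_comp_mul_jacobian_eq_zero`). Invariance under Reidemeister moves
carries the symmetry to every diagram of a classical link. -/

/-! ### First return maps of permutations of a finite set -/

section FirstReturn

variable {X : Type*} [Finite X] (π : Equiv.Perm X) (P : X → Prop)

theorem Equiv.Perm.exists_iterate_succ_of_prop {x : X} (hx : P x) : ∃ m : ℕ, P (π^[m + 1] x) := by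
  refine ⟨orderOf π - 1, ?_⟩
  rw [Nat.sub_add_cancel (orderOf_pos π), ← Equiv.Perm.coe_pow, pow_orderOf_eq_one]
  exact hx

open Classical in
/-- The number of points outside `P` between `x` and the next point of `P` on the orbit of `x`. -/
noncomputable def Equiv.Perm.returnTime (x : {x // P x}) : ℕ :=
  Nat.find (π.exists_iterate_succ_of_prop P x.2)

open Classical in
theorem Equiv.Perm.returnTime_spec (x : {x // P x}) : P (π^[π.returnTime P x + 1] x) :=
  Nat.find_spec (π.exists_iterate_succ_of_prop P x.2)

open Classical in
theorem Equiv.Perm.not_of_lt_returnTime {x : {x // P x}} {l : ℕ} (hl : l < π.returnTime P x) :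
    ¬ P (π^[l + 1] x) :=
  Nat.find_min (π.exists_iterate_succ_of_prop P x.2) hl

open Classical in
theorem Equiv.Perm.returnTime_le {x : {x // P x}} {l : ℕ} (hl : P (π^[l + 1] x)) :
    π.returnTime P x ≤ l :=
  Nat.find_min' (π.exists_iterate_succ_of_prop P x.2) hl

/-- The first return map to `P`. -/
noncomputable def Equiv.Perm.returnMap (x : {x // P x}) : {x // P x} :=
  ⟨π^[π.returnTime P x + 1] x, π.returnTime_spec P x⟩

theorem Equiv.Perm.returnMap_injective : Function.Injective (π.returnMap P) := by
  have key : ∀ x y : {x // P x}, π.returnTime P x ≤ π.returnTime P y →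
      π.returnMap P x = π.returnMap P y → x = y := by
    intro x y hle h
    -- Cancelling the shorter iterate leaves `x = π^[d] y`; for positive `d` the orbit of `y` would
    -- meet `P` at `x` before its return time.
    have h' : π^[π.returnTime P x + 1] (x : X) = π^[π.returnTime P y + 1] (y : X) :=
      congrArg Subtype.val h
    obtain ⟨d, hd⟩ := Nat.exists_eq_add_of_le hle
    rw [hd, show π.returnTime P x + d + 1 = (π.returnTime P x + 1) + d by ring,
      Function.iterate_add_apply π (π.returnTime P x + 1) d] at h'
    have h2 : (x : X) = π^[d] (y : X) := (π.injective.iterate _) h'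
    cases d with
    | zero => exact Subtype.ext h2
    | succ d =>
      refine absurd ?_ (π.not_of_lt_returnTime P (x := y) (l := d) (by omega))
      rw [← h2]
      exact x.2
  intro x y h
  rcases le_total (π.returnTime P x) (π.returnTime P y) with hle | hle
  · exact key x y hle h
  · exact (key y x hle h.symm).symm

/-- The first return map to `P`, as a permutation. -/
noncomputable def Equiv.Perm.firstReturn : Equiv.Perm {x // P x} :=
  Equiv.ofBijective (π.returnMap P) (Finite.injective_iff_bijective.1 (π.returnMap_injective P))

theorem Equiv.Perm.coe_firstReturn (x : {x // P x}) :
    (π.firstReturn P x : X) = π^[π.returnTime P x + 1] x := rfl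

/-- This is what makes erasure preserve the circles. A return step is a power of `π`; conversely, a
power of `π` joining two points of `P` splits into successive return steps. -/
theorem Equiv.Perm.firstReturn_sameCycle_iff (x y : {x // P x}) :
    (π.firstReturn P).SameCycle x y ↔ π.SameCycle (x : X) y := by
  constructor
  · intro h
    obtain ⟨i, -, hi⟩ := h.exists_pow_eq'
    clear h
    induction i generalizing x with
    | zero => simp only [pow_zero, Equiv.Perm.one_apply] at hi; rw [hi]
    | succ i ih =>
      rw [pow_succ, Equiv.Perm.mul_apply] at hi
      refine Equiv.Perm.SameCycle.trans ?_ (ih _ hi)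
      rw [π.coe_firstReturn P, ← Equiv.Perm.coe_pow]
      exact ⟨(π.returnTime P x + 1 : ℕ), by rw [zpow_natCast]⟩
  · intro h
    obtain ⟨i, -, hi⟩ := h.exists_pow_eq'
    clear h
    induction i using Nat.strong_induction_on generalizing x with
    | _ i ih =>
      cases i with
      | zero => simp only [pow_zero, Equiv.Perm.one_apply] at hi; rw [Subtype.ext hi]
      | succ i =>
        have hle : π.returnTime P x ≤ i := by
          apply π.returnTime_le P
          rw [← Equiv.Perm.coe_pow, hi]
          exact y.2
        have := ih (i - π.returnTime P x) (by omega) (π.firstReturn P x) (by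
          rw [← hi, π.coe_firstReturn P, Equiv.Perm.coe_pow, Equiv.Perm.coe_pow,
            ← Function.iterate_add_apply, show i - π.returnTime P x + (π.returnTime P x + 1) = i + 1 by
              omega])
        exact (Equiv.Perm.sameCycle_apply_left.1 this)

end FirstReturn

/-! ### Erasing arrows from a Gauss diagram -/

namespace GaussDiagram

variable {n : ℕ}

/-- The endpoints of the arrows in `S` are the endpoints that lie on arrows of `S`. -/
def endpointEquiv {α : Type} (S : Set α) : {e : α × Bool // e.1 ∈ S} ≃ S × Bool where
  toFun e := (⟨e.1.1, e.2⟩, e.1.2)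
  invFun e := ⟨(e.1, e.2), e.1.2⟩
  left_inv _ := rfl
  right_inv _ := rfl

open Classical in
/-- Erase the arrows outside `S`. -/
noncomputable def erase (D : GaussDiagram n) (S : Set D.Arrow) : GaussDiagram n where
  Arrow := S
  sign a := D.sign a
  next := (endpointEquiv S).permCongr (D.next.firstReturn fun e => e.1 ∈ S)
  comp e := D.comp (Prod.map (↑) id e)
  comp_eq_iff e f := by
    rw [D.comp_eq_iff]
    have h := D.next.firstReturn_sameCycle_iff (fun e => e.1 ∈ S)
      ((endpointEquiv S).symm e) ((endpointEquiv S).symm f)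
    have h2 : ∀ (g : Equiv.Perm {e : D.Arrow × Bool // e.1 ∈ S}),
        ((endpointEquiv S).permCongr g).SameCycle e f ↔
          g.SameCycle ((endpointEquiv S).symm e) ((endpointEquiv S).symm f) := by
      intro g
      have hz : ∀ i : ℤ, ((endpointEquiv S).permCongr g) ^ i = (endpointEquiv S).permCongr (g ^ i) :=
        fun i => (map_zpow (endpointEquiv S).permCongrHom g i).symm
      simp only [Equiv.Perm.SameCycle, hz, Equiv.permCongr_apply, Equiv.eq_symm_apply]
    rw [h2, h]
    rfl

/-- The arrows that remain after erasing the others. -/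
def eraseEmbedding (D : GaussDiagram n) (S : Set D.Arrow) : (D.erase S).Arrow ↪ D.Arrow :=
  ⟨fun a : S => a, Subtype.val_injective⟩

theorem range_eraseEmbedding (D : GaussDiagram n) (S : Set D.Arrow) :
    Set.range (D.eraseEmbedding S) = S :=
  Subtype.range_val

theorem erase_isErasure (D : GaussDiagram n) (S : Set D.Arrow) :
    D.IsErasure (D.erase S) (D.eraseEmbedding S) where
  sign_eq _ := rfl
  comp_eq _ := rfl
  next_eq e := by
    refine ⟨D.next.returnTime (fun e => e.1 ∈ S) ((endpointEquiv S).symm e), rfl, ?_⟩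
    intro l hl
    rw [range_eraseEmbedding]
    exact D.next.not_of_lt_returnTime (fun e => e.1 ∈ S) hl

/-! ### Invariance of the linking numbers under the moves -/

/-- Reindexing along `f` accounts for the surviving arrows, so only the total contribution of the
erased set `T` matters. -/
theorem IsErasure.lk_eq {D D' : GaussDiagram n} {f : D'.Arrow ↪ D.Arrow} (hf : D.IsErasure D' f)
    {T : Finset D.Arrow} (hT : Set.range f = (T : Set D.Arrow)ᶜ) (j k : Fin n)
    (h0 : haveI := Classical.decEq (Fin n); ∑ a ∈ T,
      (if D.comp (D.tail a) = j ∧ D.comp (D.head a) = k then (D.sign a : ℤ) else 0) = 0) :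
    D.lk j k = D'.lk j k := by
  classical
  unfold lk
  rw [← Finset.sum_compl_add_sum T]
  have hm : Tᶜ = Finset.univ.map f := by
    ext a
    have := Set.ext_iff.1 hT a
    simp at this
    simp [this]
  rw [hm, Finset.sum_map]
  have h1 : ∀ a, D'.comp (D'.tail a) = D.comp (D.tail (f a)) := fun a => hf.comp_eq _
  have h2 : ∀ a, D'.comp (D'.head a) = D.comp (D.head (f a)) := fun a => hf.comp_eq _
  simp only [h1, h2, hf.sign_eq]
  convert add_zero _
  convert h0

theorem Adj.comp_eq {D : GaussDiagram n} {e f : D.Arrow × Bool} {δ : ℤˣ} (h : D.Adj e f δ) :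
    D.comp e = D.comp f := by
  rw [D.comp_eq_iff]
  rcases h with ⟨-, h⟩ | ⟨-, h⟩
  · exact ⟨1, by simpa using h⟩
  · exact Equiv.Perm.SameCycle.symm ⟨1, by simpa using h⟩

theorem comp_next (D : GaussDiagram n) (e : D.Arrow × Bool) : D.comp (D.next e) = D.comp e := by
  rw [D.comp_eq_iff]; exact Equiv.Perm.sameCycle_apply_left.2 (Equiv.Perm.SameCycle.refl _ _)

theorem comp_swap (D : GaussDiagram n) [DecidableEq (D.Arrow × Bool)]
    {e f : D.Arrow × Bool} (h : D.comp e = D.comp f) (x : D.Arrow × Bool) :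
    D.comp (Equiv.swap e f x) = D.comp x := by
  rw [Equiv.swap_apply_def]; split_ifs with h1 h2
  · rw [h1, h]
  · rw [h2, h]
  · rfl

theorem lk_rearrange (D : GaussDiagram n) (σ : Equiv.Perm (D.Arrow × Bool))
    (h : ∀ x, D.comp (σ x) = D.comp x) (j k : Fin n) : (D.rearrange σ).lk j k = D.lk j k := by
  have h' : ∀ x, D.comp (σ⁻¹ x) = D.comp x := fun x => by
    rw [← h (σ⁻¹ x), Equiv.Perm.coe_inv, Equiv.apply_symm_apply]
  unfold lk
  simp only [h']
  rfl

/-- Distinctness of `j` and `k` matters only for R1, whose arrow has both ends on one circle and may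
contribute to a diagonal number. -/
theorem ReidemeisterMove.lk_eq {D D' : GaussDiagram n} (h : ReidemeisterMove D D') {j k : Fin n}
    (hjk : j ≠ k) : D.lk j k = D'.lk j k := by
  classical
  cases h with
  | rename f hf hr => exact hf.lk_eq (T := ∅) (by simp [hr]) j k (by simp)
  | r1 f hf a hr p ha =>
    refine hf.lk_eq (T := {a}) (by simp [hr]) j k ?_
    rw [Finset.sum_singleton, if_neg]
    rintro ⟨h1, h2⟩
    exact hjk (by rw [← h1, ← h2, ha.comp_eq])
  | r2 f hf a b hab hr p q ho hu hs =>
    refine hf.lk_eq (T := {a, b}) (by simp [hr]) j k ?_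
    rw [Finset.sum_pair hab, ho.comp_eq, hu.comp_eq, hs]
    split_ifs <;> simp
  | r3 x y z hxy hxz hyz p q r ht hm hb h₁ h₂ =>
    rw [lk_rearrange]
    intro e
    simp only [Equiv.Perm.mul_apply]
    rw [D.comp_swap ht.comp_eq, D.comp_swap hm.comp_eq, D.comp_swap hb.comp_eq]

theorem lk_exchange (D : GaussDiagram n) {e f : D.Arrow × Bool} (h : D.next e = f) (j k : Fin n) :
    (D.exchange e f).lk j k = D.lk j k := by
  classical
  apply lk_rearrange
  apply D.comp_swap
  rw [← h, comp_next]

theorem ForbiddenMove.lk_eq {D D' : GaussDiagram n} (h : ForbiddenMove D D') (j k : Fin n) :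
    D.lk j k = D'.lk j k := by
  cases h with
  | tail_tail a b hab h => exact (D.lk_exchange h j k).symm
  | head_head a b hab h => exact (D.lk_exchange h j k).symm
  | tail_head a b hab h => exact (D.lk_exchange h j k).symm
  | head_tail a b hab h => exact (D.lk_exchange h j k).symm

theorem FusedEquiv.lk_eq {D D' : GaussDiagram n} (h : D.FusedEquiv D') {j k : Fin n}
    (hjk : j ≠ k) : D.lk j k = D'.lk j k := by
  induction h with
  | rel _ _ h => exact h.elim (fun h => h.lk_eq hjk) (fun h => h.lk_eq j k)
  | refl => rfl
  | symm _ _ _ ih => exact ih.symm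
  | trans _ _ _ _ _ ih1 ih2 => exact ih1.trans ih2

theorem ReidemeisterEquiv.lk_eq {D D' : GaussDiagram n} (h : D.ReidemeisterEquiv D') {j k : Fin n}
    (hjk : j ≠ k) : D.lk j k = D'.lk j k := by
  induction h with
  | rel _ _ h => exact h.lk_eq hjk
  | refl => rfl
  | symm _ _ _ ih => exact ih.symm
  | trans _ _ _ _ _ ih1 ih2 => exact ih1.trans ih2

/-! ### Sliding endpoints and reducing a diagram -/

theorem forbiddenMove_exchange (D : GaussDiagram n) {e f : D.Arrow × Bool} (hef : e.1 ≠ f.1)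
    (h : D.next e = f) : ForbiddenMove D (D.exchange e f) := by
  obtain ⟨a, s⟩ := e
  obtain ⟨b, t⟩ := f
  cases s <;> cases t
  · exact .head_head a b hef h
  · exact .head_tail a b hef h
  · exact .tail_head a b hef h
  · exact .tail_tail a b hef h

theorem rearrange_rearrange (D : GaussDiagram n) (σ τ : Equiv.Perm (D.Arrow × Bool)) :
    (D.rearrange σ).rearrange τ = D.rearrange (τ * σ) := by
  simp only [rearrange, mul_inv_rev, mul_assoc, Equiv.Perm.mul_apply]

theorem rearrange_one (D : GaussDiagram n) : D.rearrange 1 = D := by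
  cases D
  simp [rearrange]

/-- An endpoint `e` can be moved forward until it is directly followed by a given endpoint `f` of
its circle, unless it is stopped by the other endpoint of its arrow. -/
theorem exists_fusedEquiv_next (d : ℕ) : ∀ (D : GaussDiagram n) (e f : D.Arrow × Bool), e ≠ f →
    ((e.1, !e.2) = f ∨ D.comp (e.1, !e.2) ≠ D.comp e) → (D.next)^[d + 1] e = f →
    ∃ τ : Equiv.Perm (D.Arrow × Bool), (∀ x, D.comp (τ x) = D.comp x) ∧
      (∀ x, D.comp x ≠ D.comp e → τ x = x) ∧ D.FusedEquiv (D.rearrange τ) ∧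
      (D.rearrange τ).next e = f := by
  classical
  induction d with
  | zero =>
    intro D e f hef ho h
    refine ⟨1, fun _ => rfl, fun _ _ => rfl, ?_, ?_⟩
    · rw [rearrange_one]; exact .refl _
    · simpa using h
  | succ d ih =>
    intro D e f hef ho h
    by_cases hf : D.next e = f
    · refine ⟨1, fun _ => rfl, fun _ _ => rfl, ?_, ?_⟩
      · rw [rearrange_one]; exact .refl _
      · simpa using hf
    have hne : D.next e ≠ e := by
      intro he
      apply hef
      rw [← h]
      exact (Function.iterate_fixed he _).symm
    -- A forbidden move needs two different arrows. The only possible obstacle is the other endpoint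
    -- of the arrow of `e`, which by `ho` is the target itself or lies on another circle.
    have h1 : e.1 ≠ (D.next e).1 := by
      intro h1
      have h2 : D.next e = (e.1, !e.2) := by
        refine Prod.ext h1.symm ?_
        by_contra h3
        exact hne (Prod.ext h1.symm (by simpa using h3))
      rcases ho with ho | ho
      · exact hf (h2.trans ho)
      · exact ho (by rw [← h2, comp_next])
    have hc : D.comp e = D.comp (D.next e) := (D.comp_next e).symm
    set σ : Equiv.Perm (D.Arrow × Bool) := Equiv.swap e (D.next e) with hσ
    have hσc : ∀ x, D.comp (σ x) = D.comp x := D.comp_swap hc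
    have hσi : σ⁻¹ = σ := by simp [hσ]
    have hit : ∀ m x, ((D.rearrange σ).next)^[m] x = σ ((D.next)^[m] (σ x)) := by
      intro m x
      have : ((σ * D.next * σ⁻¹) ^ m) x = (σ * D.next ^ m * σ⁻¹) x := by rw [conj_pow]
      rw [hσi] at this
      simpa [Equiv.Perm.coe_pow, hσi] using this
    -- After the exchange `e` occupies the place of its successor, one step closer to `f`.
    have hit2 : ((D.rearrange σ).next)^[d + 1] e = f := by
      rw [hit]
      have : σ e = D.next e := by simp [hσ]
      rw [this, ← Function.iterate_succ_apply, h]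
      exact Equiv.swap_apply_of_ne_of_ne hef.symm (Ne.symm hf)
    obtain ⟨τ, hτc, hτf, hτe, hτn⟩ := ih (D.rearrange σ) e f hef (by
      simpa only [hσi, hσc] using ho) hit2
    simp only [hσi, hσc] at hτc hτf
    refine ⟨τ * σ, fun x => ?_, fun x hx => ?_, ?_, ?_⟩
    · rw [Equiv.Perm.mul_apply, hτc, hσc]
    · rw [Equiv.Perm.mul_apply, hτf _ (by rwa [hσc])]
      refine Equiv.swap_apply_of_ne_of_ne ?_ ?_
      · rintro rfl; exact hx rfl
      · rintro rfl; exact hx hc.symm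
    · rw [← rearrange_rearrange]
      exact .trans _ _ _ (.rel _ _ (Or.inr (D.forbiddenMove_exchange h1 rfl))) hτe
    · simpa only [mul_inv_rev, mul_assoc] using hτn

theorem exists_iterate_succ_of_comp_eq (D : GaussDiagram n) {e f : D.Arrow × Bool}
    (h : D.comp e = D.comp f) : ∃ d : ℕ, (D.next)^[d + 1] e = f := by
  obtain ⟨i, hi, -, h⟩ := ((D.comp_eq_iff e f).1 h).exists_pow_eq''
  refine ⟨i - 1, ?_⟩
  rw [Nat.sub_add_cancel hi, ← Equiv.Perm.coe_pow, h]

theorem card_erase_lt (D : GaussDiagram n) {S : Set D.Arrow} {a : D.Arrow} (ha : a ∉ S) :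
    Nat.card (D.erase S).Arrow < Nat.card D.Arrow :=
  Finite.card_subtype_lt (p := (· ∈ S)) ha

/-- The tail slides forward to the head of its own arrow, and R1 then applies. -/
theorem exists_fusedEquiv_card_lt_of_self (D : GaussDiagram n) {a : D.Arrow}
    (ha : D.comp (D.tail a) = D.comp (D.head a)) :
    ∃ D' : GaussDiagram n, D.FusedEquiv D' ∧ Nat.card D'.Arrow < Nat.card D.Arrow := by
  obtain ⟨d, hd⟩ := D.exists_iterate_succ_of_comp_eq ha
  obtain ⟨τ, -, -, he, hn⟩ := exists_fusedEquiv_next d D (D.tail a) (D.head a)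
    (by simp [tail, head]) (Or.inl rfl) hd
  refine ⟨(D.rearrange τ).erase {a}ᶜ, .trans _ _ _ he (.rel _ _ (Or.inl ?_)),
    (D.rearrange τ).card_erase_lt (a := a) (by simp)⟩
  exact .r1 _ ((D.rearrange τ).erase_isErasure _) a (range_eraseEmbedding _ _) 1 (Or.inl ⟨rfl, hn⟩)

/-- Slide the tails together, then the heads, and cancel by R2. Neither slide is blocked, because
the other endpoint of `a` is on a different circle. -/
theorem exists_fusedEquiv_card_lt_of_parallel (D : GaussDiagram n) {a b : D.Arrow}
    (ht : D.comp (D.tail a) = D.comp (D.tail b)) (hh : D.comp (D.head a) = D.comp (D.head b))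
    (ha : D.comp (D.tail a) ≠ D.comp (D.head a)) (hs : D.sign a ≠ D.sign b) :
    ∃ D' : GaussDiagram n, D.FusedEquiv D' ∧ Nat.card D'.Arrow < Nat.card D.Arrow := by
  have hab : a ≠ b := by rintro rfl; exact hs rfl
  obtain ⟨d, hd⟩ := D.exists_iterate_succ_of_comp_eq ht
  obtain ⟨τ, hc, -, he, hn⟩ := exists_fusedEquiv_next d D (D.tail a) (D.tail b)
    (by simpa [tail] using hab) (Or.inr (Ne.symm ha)) hd
  set E := D.rearrange τ with hE
  have hcE : ∀ x, E.comp x = D.comp x := fun x => by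
    change D.comp (τ⁻¹ x) = _
    rw [← hc (τ⁻¹ x), Equiv.Perm.coe_inv, Equiv.apply_symm_apply]
  obtain ⟨d', hd'⟩ := E.exists_iterate_succ_of_comp_eq (e := D.head a) (f := D.head b)
    (by rw [hcE, hcE, hh])
  obtain ⟨ρ, -, hf', he', hn'⟩ := exists_fusedEquiv_next d' E (D.head a) (D.head b)
    (by simpa [head] using hab) (Or.inr (by rw [hcE, hcE]; exact ha)) hd'
  -- Sliding the heads moves nothing off their circle, so the tails remain neighbours.
  have hfa : ρ (D.tail a) = D.tail a := hf' _ (by rw [hcE, hcE]; exact ha)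
  have hfb : ρ (D.tail b) = D.tail b := hf' _ (by rw [hcE, hcE, ← ht]; exact ha)
  refine ⟨(E.rearrange ρ).erase {a, b}ᶜ, .trans _ _ _ he (.trans _ _ _ he' (.rel _ _ (Or.inl ?_))),
    (E.rearrange ρ).card_erase_lt (a := a) (by simp)⟩
  refine .r2 _ ((E.rearrange ρ).erase_isErasure _) a b hab (range_eraseEmbedding _ _) 1 1 (Or.inl ⟨rfl, ?_⟩)
    (Or.inl ⟨rfl, hn'⟩) (Int.units_ne_iff_eq_neg.1 hs)
  change (ρ * E.next * ρ⁻¹) (D.tail a) = D.tail b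
  rw [Equiv.Perm.mul_apply, Equiv.Perm.mul_apply, Equiv.Perm.inv_eq_iff_eq.2 hfa.symm, hn, hfb]

theorem exists_fusedEquiv_isReduced (D : GaussDiagram n) :
    ∃ D' : GaussDiagram n, D.FusedEquiv D' ∧ D'.IsReduced := by
  induction hN : Nat.card D.Arrow using Nat.strong_induction_on generalizing D with
  | _ N ih =>
    by_cases hD : D.IsReduced
    · exact ⟨D, .refl _, hD⟩
    obtain ⟨E, hE, hlt⟩ : ∃ D' : GaussDiagram n, D.FusedEquiv D' ∧
        Nat.card D'.Arrow < Nat.card D.Arrow := by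
      by_cases h1 : ∃ a, D.comp (D.tail a) = D.comp (D.head a)
      · exact D.exists_fusedEquiv_card_lt_of_self h1.choose_spec
      push Not at h1
      by_contra h2
      refine hD ⟨h1, fun a b ht hh => ?_⟩
      by_contra hs
      exact h2 (D.exists_fusedEquiv_card_lt_of_parallel ht hh (h1 a) hs)
    obtain ⟨D', hD', hr⟩ := ih _ (hN ▸ hlt) E rfl
    exact ⟨D', .trans _ _ _ hE hD', hr⟩

/-! ### Entries, uniqueness and symmetry of the forbidden matrix -/

theorem labelMatrix_shrink_apply (D : GaussDiagram n) (j k : Fin n) :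
    D.shrink.labelMatrix j k = D.lk j k := rfl

theorem IsReduced.lk_self {D : GaussDiagram n} (h : D.IsReduced) (j : Fin n) : D.lk j j = 0 := by
  unfold lk
  refine Finset.sum_eq_zero fun a _ => if_neg ?_
  rintro ⟨h1, h2⟩
  exact h.no_self a (h1.trans h2.symm)

theorem IsForbiddenMatrix.apply_eq {D : GaussDiagram n} {M : Matrix (Fin n) (Fin n) ℤ}
    (h : D.IsForbiddenMatrix M) (j k : Fin n) : M j k = if j = k then 0 else D.lk j k := by
  obtain ⟨_, ⟨D', hD', hr, rfl⟩, rfl⟩ := h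
  rw [labelMatrix_shrink_apply]
  split_ifs with hjk
  · rw [hjk, hr.lk_self]
  · exact (hD'.lk_eq hjk).symm

theorem existsUnique_isForbiddenMatrix (D : GaussDiagram n) :
    ∃! M : Matrix (Fin n) (Fin n) ℤ, D.IsForbiddenMatrix M := by
  obtain ⟨D', hD', hr⟩ := D.exists_fusedEquiv_isReduced
  refine ⟨_, ⟨_, ⟨D', hD', hr, rfl⟩, rfl⟩, fun M hM => ?_⟩
  ext j k
  rw [hM.apply_eq, IsForbiddenMatrix.apply_eq ⟨_, ⟨D', hD', hr, rfl⟩, rfl⟩]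

theorem IsForbiddenMatrix.isSymm {D : GaussDiagram n} {M : Matrix (Fin n) (Fin n) ℤ}
    (h : D.IsForbiddenMatrix M) (hlk : ∀ j k, D.lk j k = D.lk k j) : M.IsSymm := by
  ext j k
  rw [Matrix.transpose_apply, h.apply_eq, h.apply_eq, hlk k j]
  simp only [eq_comm]

end GaussDiagram

/-! ### Intersection numbers of closed plane curves -/

section PlaneCurves

open MeasureTheory Set Filter Topology

/-- For two closed plane curves `a`, `b`, the pull-back of a product form `ψ x dx ∧ ψ y dy` by
`(s, t) ↦ a s - b t` is exact on the torus. -/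
theorem integral_comp_mul_jacobian_eq_zero {Ψ ψ ψ' a₁ a₂ b₁ b₂ a₁' a₂' b₁' b₂' : ℝ → ℝ} {T : ℝ}
    (hΨ : ∀ x, HasDerivAt Ψ (ψ x) x) (hψ : ∀ x, HasDerivAt ψ (ψ' x) x) (hψ' : Continuous ψ')
    (ha₁ : ∀ x, HasDerivAt a₁ (a₁' x) x) (ha₂ : ∀ x, HasDerivAt a₂ (a₂' x) x)
    (hb₁ : ∀ x, HasDerivAt b₁ (b₁' x) x) (hb₂ : ∀ x, HasDerivAt b₂ (b₂' x) x)
    (ca₁ : Continuous a₁') (ca₂ : Continuous a₂') (cb₁ : Continuous b₁') (cb₂ : Continuous b₂')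
    (pa₁ : a₁.Periodic T) (pa₂ : a₂.Periodic T) (pb₁ : b₁.Periodic T) (pb₂ : b₂.Periodic T)
    (c d : ℝ) :
    ∫ s in c..c + T, ∫ t in d..d + T, ψ (a₁ s - b₁ t) * ψ (a₂ s - b₂ t) *
      (a₁' s * b₂' t - a₂' s * b₁' t) = 0 := by
  have cΨ : Continuous Ψ := continuous_iff_continuousAt.2 fun x => (hΨ x).continuousAt
  have cψ : Continuous ψ := continuous_iff_continuousAt.2 fun x => (hψ x).continuousAt
  have c1 : Continuous a₁ := continuous_iff_continuousAt.2 fun x => (ha₁ x).continuousAt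
  have c2 : Continuous a₂ := continuous_iff_continuousAt.2 fun x => (ha₂ x).continuousAt
  have c3 : Continuous b₁ := continuous_iff_continuousAt.2 fun x => (hb₁ x).continuousAt
  have c4 : Continuous b₂ := continuous_iff_continuousAt.2 fun x => (hb₂ x).continuousAt
  -- `A` is the `s`-derivative of `b₂' Ψ ψ` and `B` the `t`-derivative of `a₂' Ψ ψ`. Their `ψ'`
  -- terms cancel in the sum, and neither `a₂'` nor `b₂'` has to be differentiated.
  set A : ℝ → ℝ → ℝ := fun s t => b₂' t *
    (ψ (a₁ s - b₁ t) * a₁' s * ψ (a₂ s - b₂ t) + Ψ (a₁ s - b₁ t) * (ψ' (a₂ s - b₂ t) * a₂' s)) with hA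
  set B : ℝ → ℝ → ℝ := fun s t => a₂' s *
    (ψ (a₁ s - b₁ t) * (-b₁' t) * ψ (a₂ s - b₂ t) + Ψ (a₁ s - b₁ t) * (ψ' (a₂ s - b₂ t) * (-b₂' t)))
    with hB
  have cA : Continuous (Function.uncurry A) := by
    simp only [hA, Function.uncurry_def]; fun_prop
  have cB : Continuous (Function.uncurry B) := by
    simp only [hB, Function.uncurry_def]; fun_prop
  have hAB : ∀ s t, ψ (a₁ s - b₁ t) * ψ (a₂ s - b₂ t) * (a₁' s * b₂' t - a₂' s * b₁' t) =
      A s t + B s t := by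
    intro s t; simp only [hA, hB]; ring
  have iA : ∀ t, ∫ s in c..c + T, A s t = 0 := by
    intro t
    rw [intervalIntegral.integral_eq_sub_of_hasDerivAt
      (f := fun s => b₂' t * (Ψ (a₁ s - b₁ t) * ψ (a₂ s - b₂ t)))]
    · simp only [pa₁ c, pa₂ c, sub_self]
    · intro s _
      exact (((hΨ _).comp s ((ha₁ s).sub_const _)).mul
        ((hψ _).comp s ((ha₂ s).sub_const _))).const_mul _
    · exact (cA.comp (by fun_prop : Continuous fun s => (s, t))).intervalIntegrable _ _
  have iB : ∀ s, ∫ t in d..d + T, B s t = 0 := by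
    intro s
    rw [intervalIntegral.integral_eq_sub_of_hasDerivAt
      (f := fun t => a₂' s * (Ψ (a₁ s - b₁ t) * ψ (a₂ s - b₂ t)))]
    · simp only [pb₁ d, pb₂ d, sub_self]
    · intro t _
      exact (((hΨ _).comp t ((hb₁ t).const_sub _)).mul
        ((hψ _).comp t ((hb₂ t).const_sub _))).const_mul _
    · exact (cB.comp (by fun_prop : Continuous fun t => (s, t))).intervalIntegrable _ _
  simp only [hAB]
  have h1 : ∀ s, ∫ t in d..d + T, (A s t + B s t) = ∫ t in d..d + T, A s t := by
    intro s
    rw [intervalIntegral.integral_add, iB, add_zero]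
    · exact (cA.comp (by fun_prop : Continuous fun t => (s, t))).intervalIntegrable _ _
    · exact (cB.comp (by fun_prop : Continuous fun t => (s, t))).intervalIntegrable _ _
  simp only [h1]
  rw [intervalIntegral_intervalIntegral_swap]
  · simp only [iA, intervalIntegral.integral_zero]
  · exact (cA.continuousOn.integrableOn_compact (isCompact_uIcc.prod isCompact_uIcc)).mono_set
      (prod_mono uIoc_subset_uIcc uIoc_subset_uIcc)

theorem exists_smooth_approximate_delta {ε : ℝ} (hε : 0 < ε) : ∃ Ψ ψ ψ' : ℝ → ℝ,
    (∀ x, HasDerivAt Ψ (ψ x) x) ∧ (∀ x, HasDerivAt ψ (ψ' x) x) ∧ Continuous ψ' ∧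
      (∀ x, ψ x ≠ 0 → |x| < ε) ∧ ∫ x, ψ x = 1 := by
  let f : ContDiffBump (0 : ℝ) := ⟨ε / 2, ε, by positivity, by linarith⟩
  have hf : ContDiff ℝ 1 (f.normed volume) := f.contDiff_normed
  have hc : Continuous (f.normed volume) := hf.continuous
  refine ⟨fun x => ∫ t in (0 : ℝ)..x, f.normed volume t, f.normed volume,
    deriv (f.normed volume), fun x => ?_, fun x => ?_, ?_, fun x hx => ?_, f.integral_normed⟩
  · exact intervalIntegral.integral_hasDerivAt_right (hc.intervalIntegrable _ _)
      (hc.stronglyMeasurableAtFilter _ _) hc.continuousAt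
  · exact (hf.differentiable one_ne_zero x).hasDerivAt
  · exact hf.continuous_deriv le_rfl
  · have : x ∈ Function.support (f.normed volume) := hx
    rw [f.support_normed_eq] at this
    simpa [Real.dist_eq] using this

/-- The linear map of the plane with the matrix `!![a, b; c, d]`. -/
noncomputable def planarMap (a b c d : ℝ) : ℝ × ℝ →L[ℝ] ℝ × ℝ :=
  (a • ContinuousLinearMap.fst ℝ ℝ ℝ + b • ContinuousLinearMap.snd ℝ ℝ ℝ).prod
    (c • ContinuousLinearMap.fst ℝ ℝ ℝ + d • ContinuousLinearMap.snd ℝ ℝ ℝ)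

theorem det_planarMap (a b c d : ℝ) : (planarMap a b c d).det = a * d - b * c := by
  rw [planarMap, ← Matrix.toLin_finTwoProd_toContinuousLinearMap]
  simp only [LinearMap.det_toContinuousLinearMap, LinearMap.det_toLin, Matrix.det_fin_two_of]

theorem planarMap_eq_smul_add (a b c d : ℝ) : planarMap a b c d =
    a • planarMap 1 0 0 0 + b • planarMap 0 1 0 0 + c • planarMap 0 0 1 0 +
      d • planarMap 0 0 0 1 := by
  ext <;> simp [planarMap]

/-- Change of variables on a set where the Jacobian has the constant sign `ε`. -/
theorem setIntegral_comp_mul_det_of_abs {F : ℝ × ℝ → ℝ × ℝ} {F' : ℝ × ℝ → ℝ × ℝ →L[ℝ] ℝ × ℝ}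
    {U : Set (ℝ × ℝ)} (hU : IsOpen U) (hF : ∀ x ∈ U, HasFDerivAt F (F' x) x) (hi : InjOn F U)
    {ε : ℝ} (hε : ∀ x ∈ U, (F' x).det = ε * |(F' x).det|) {φ : ℝ × ℝ → ℝ}
    (hφ : Function.support φ ⊆ F '' U) :
    ∫ x in U, φ (F x) * (F' x).det = ε * ∫ x, φ x := by
  rw [← setIntegral_eq_integral_of_forall_compl_eq_zero (s := F '' U)
    (fun x hx => by_contra fun h => hx (hφ h)),
    integral_image_eq_integral_abs_det_fderiv_smul volume hU.measurableSet
      (fun x hx => (hF x hx).hasFDerivWithinAt) hi, ← integral_const_mul]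
  refine setIntegral_congr_fun hU.measurableSet fun x hx => ?_
  change φ (F x) * (F' x).det = ε * (|(F' x).det| * φ (F x))
  nth_rw 1 [hε x hx]
  ring

/-- Inverse function theorem, with the neighbourhood shrunk until the Jacobian keeps its sign. -/
theorem exists_isOpen_injOn_of_det_ne_zero {F : ℝ × ℝ → ℝ × ℝ}
    {F' : ℝ × ℝ → ℝ × ℝ →L[ℝ] ℝ × ℝ} (hF : ∀ x, HasFDerivAt F (F' x) x) (hF' : Continuous F')
    {p : ℝ × ℝ} (hp : (F' p).det ≠ 0) {N : Set (ℝ × ℝ)} (hN : N ∈ 𝓝 p) :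
    ∃ U ⊆ N, p ∈ U ∧ IsOpen U ∧ InjOn F U ∧ F '' U ∈ 𝓝 (F p) ∧
      ∀ x ∈ U, (F' x).det = SignType.sign (F' p).det * |(F' x).det| := by
  have hs : HasStrictFDerivAt F
      ((F' p).toContinuousLinearEquivOfDetNeZero hp : ℝ × ℝ →L[ℝ] ℝ × ℝ) p := by
    rw [ContinuousLinearMap.coe_toContinuousLinearEquivOfDetNeZero]
    exact hasStrictFDerivAt_of_hasFDerivAt_of_continuousAt (Eventually.of_forall hF)
      hF'.continuousAt
  have hd : Continuous fun x => (F' x).det := ContinuousLinearMap.continuous_det.comp hF'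
  obtain ⟨N', hN', hNo, hpN⟩ := mem_nhds_iff.1 hN
  set e := hs.toOpenPartialHomeomorph F with he
  refine ⟨e.source ∩ N' ∩ {x | 0 < (F' p).det * (F' x).det}, fun x hx => hN' hx.1.2,
    ⟨⟨hs.mem_toOpenPartialHomeomorph_source, hpN⟩, mul_self_pos.2 hp⟩,
    (e.open_source.inter hNo).inter (isOpen_lt continuous_const (continuous_const.mul hd)),
    fun x hx y hy h => e.injOn hx.1.1 hy.1.1 h, ?_, fun x hx => ?_⟩
  · rw [← hs.map_nhds_eq_of_equiv]
    refine image_mem_map (IsOpen.mem_nhds ?_ ?_)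
    · exact (e.open_source.inter hNo).inter (isOpen_lt continuous_const (continuous_const.mul hd))
    · exact ⟨⟨hs.mem_toOpenPartialHomeomorph_source, hpN⟩, mul_self_pos.2 hp⟩
  · have h : 0 < (F' p).det * (F' x).det := hx.2
    rcases pos_and_pos_or_neg_and_neg_of_mul_pos h with ⟨h1, h2⟩ | ⟨h1, h2⟩
    · rw [sign_pos h1, abs_of_pos h2]; simp
    · rw [sign_neg h1, abs_of_neg h2]; simp

/-- The degree formula: if a `C¹` map of the plane has finitely many zeros in a compact set, all of
them regular and interior, then the integral of the pull-back of a bump form concentrated near `0`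
counts them with signs. -/
theorem exists_forall_setIntegral_comp_mul_det {F : ℝ × ℝ → ℝ × ℝ}
    {F' : ℝ × ℝ → ℝ × ℝ →L[ℝ] ℝ × ℝ} (hF : ∀ x, HasFDerivAt F (F' x) x) (hF' : Continuous F')
    {K B : Set (ℝ × ℝ)} (hK : IsCompact K) (hBK : B ⊆ K) (hB : MeasurableSet B)
    (Z : Finset (ℝ × ℝ)) (hZ : ∀ x ∈ K, F x = 0 → x ∈ Z)
    (hZ0 : ∀ x ∈ Z, F x = 0) (hZB : ∀ x ∈ Z, B ∈ 𝓝 x) (hreg : ∀ x ∈ Z, (F' x).det ≠ 0) :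
    ∃ ε > 0, ∀ φ : ℝ × ℝ → ℝ, Continuous φ → (∀ x, φ x ≠ 0 → ‖x‖ < ε) →
      ∫ x in B, φ (F x) * (F' x).det = (∑ x ∈ Z, (SignType.sign (F' x).det : ℝ)) * ∫ x, φ x := by
  obtain ⟨N, hN, hdisj⟩ := Z.finite_toSet.t2_separation
  have hU : ∀ p : ℝ × ℝ, ∃ U : Set (ℝ × ℝ), p ∈ Z → (U ⊆ N p ∩ B ∧ p ∈ U ∧ IsOpen U ∧ InjOn F U ∧
      F '' U ∈ 𝓝 (F p) ∧ ∀ x ∈ U, (F' x).det = SignType.sign (F' p).det * |(F' x).det|) := by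
    intro p
    by_cases hp : p ∈ Z
    · obtain ⟨U, h1, h2⟩ := exists_isOpen_injOn_of_det_ne_zero hF hF' (hreg p hp)
        (inter_mem ((hN p).2.mem_nhds (hN p).1) (hZB p hp))
      exact ⟨U, fun _ => ⟨h1, h2⟩⟩
    · exact ⟨∅, fun h => absurd h hp⟩
  choose U hU using hU
  have hFc : Continuous F := continuous_iff_continuousAt.2 fun x => (hF x).continuousAt
  have hVo : IsOpen (⋃ p ∈ Z, U p) := isOpen_biUnion fun p hp => (hU p hp).2.2.1
  -- A form supported this close to `0` pulls back to zero on `K` outside the `U p`, and its support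
  -- is covered by each image `F '' U p`.
  have hW : (F '' (K \ ⋃ p ∈ Z, U p))ᶜ ∩ ⋂ p ∈ Z, F '' U p ∈ 𝓝 (0 : ℝ × ℝ) := by
    refine inter_mem (IsOpen.mem_nhds ?_ ?_) ((Filter.biInter_finset_mem Z).2 fun p hp => ?_)
    · exact ((hK.diff hVo).image hFc).isClosed.isOpen_compl
    · rintro ⟨x, ⟨hxK, hx⟩, h0⟩
      have := hZ x hxK h0
      exact hx (mem_biUnion this (hU x this).2.1)
    · have := (hU p hp).2.2.2.2.1
      rwa [hZ0 p hp] at this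
  obtain ⟨ε, hε, hεW⟩ := Metric.mem_nhds_iff.1 hW
  refine ⟨ε, hε, fun φ hφ hsupp => ?_⟩
  have hs : ∀ x, φ x ≠ 0 → x ∈ (F '' (K \ ⋃ p ∈ Z, U p))ᶜ ∩ ⋂ p ∈ Z, F '' U p :=
    fun x hx => hεW (mem_ball_zero_iff.2 (hsupp x hx))
  have hd : Continuous fun x => (F' x).det := ContinuousLinearMap.continuous_det.comp hF'
  have hint : IntegrableOn (fun x => φ (F x) * (F' x).det) K :=
    ((hφ.comp hFc).mul hd).continuousOn.integrableOn_compact hK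
  have hsub : (⋃ p ∈ Z, U p) ⊆ B := iUnion₂_subset fun p hp => (hU p hp).1.trans inter_subset_right
  rw [setIntegral_eq_of_subset_of_forall_sdiff_eq_zero hB hsub, integral_biUnion_finset,
    Finset.sum_mul]
  · refine Finset.sum_congr rfl fun p hp => ?_
    obtain ⟨-, -, h3, h4, -, h6⟩ := hU p hp
    exact setIntegral_comp_mul_det_of_abs h3 (fun x _ => hF x) h4 h6
      fun x hx => mem_iInter₂.1 (hs x hx).2 p hp
  · exact fun p hp => (hU p hp).2.2.1.measurableSet
  · exact fun p hp q hq hpq => (hdisj hp hq hpq).mono ((hU p hp).1.trans inter_subset_left)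
      ((hU q hq).1.trans inter_subset_left)
  · exact fun p hp => hint.mono_set (((hU p hp).1.trans inter_subset_right).trans hBK)
  · rintro x ⟨hxB, hx⟩
    by_contra h
    exact (hs (F x) (left_ne_zero_of_mul h)).1 ⟨x, ⟨hBK hxB, hx⟩, rfl⟩

/-- Two periodic plane curves that meet transversely have algebraic intersection number zero. -/
theorem sum_sign_eq_zero_of_interior {a₁ a₂ b₁ b₂ a₁' a₂' b₁' b₂' : ℝ → ℝ} {T : ℝ} (hT : 0 ≤ T)
    (ha₁ : ∀ x, HasDerivAt a₁ (a₁' x) x) (ha₂ : ∀ x, HasDerivAt a₂ (a₂' x) x)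
    (hb₁ : ∀ x, HasDerivAt b₁ (b₁' x) x) (hb₂ : ∀ x, HasDerivAt b₂ (b₂' x) x)
    (ca₁ : Continuous a₁') (ca₂ : Continuous a₂') (cb₁ : Continuous b₁') (cb₂ : Continuous b₂')
    (pa₁ : a₁.Periodic T) (pa₂ : a₂.Periodic T) (pb₁ : b₁.Periodic T) (pb₂ : b₂.Periodic T)
    (c d : ℝ) (Z : Finset (ℝ × ℝ))
    (hZ : ∀ s ∈ Icc c (c + T), ∀ t ∈ Icc d (d + T), a₁ s = b₁ t → a₂ s = b₂ t → (s, t) ∈ Z)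
    (hZ0 : ∀ x ∈ Z, a₁ x.1 = b₁ x.2 ∧ a₂ x.1 = b₂ x.2)
    (hZi : ∀ x ∈ Z, x.1 ∈ Ioo c (c + T) ∧ x.2 ∈ Ioo d (d + T))
    (hreg : ∀ x ∈ Z, a₁' x.1 * b₂' x.2 - a₂' x.1 * b₁' x.2 ≠ 0) :
    ∑ x ∈ Z, (SignType.sign (a₁' x.1 * b₂' x.2 - a₂' x.1 * b₁' x.2) : ℝ) = 0 := by
  -- The first coordinate of `a s - b t` is negated so that the Jacobian is the velocity determinant
  -- itself; `ψ (-x.1)` below undoes the reflection.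
  set F : ℝ × ℝ → ℝ × ℝ := fun x => (b₁ x.2 - a₁ x.1, a₂ x.1 - b₂ x.2) with hFdef
  set F' : ℝ × ℝ → ℝ × ℝ →L[ℝ] ℝ × ℝ :=
    fun x => planarMap (-a₁' x.1) (b₁' x.2) (a₂' x.1) (-b₂' x.2) with hF'def
  have hF : ∀ x, HasFDerivAt F (F' x) x := by
    intro x
    have h1 : HasFDerivAt (fun x : ℝ × ℝ => x.1) (ContinuousLinearMap.fst ℝ ℝ ℝ) x := hasFDerivAt_fst
    have h2 : HasFDerivAt (fun x : ℝ × ℝ => x.2) (ContinuousLinearMap.snd ℝ ℝ ℝ) x := hasFDerivAt_snd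
    have e1 := ((hb₁ x.2).comp_hasFDerivAt x h2).sub ((ha₁ x.1).comp_hasFDerivAt x h1)
    have e2 := ((ha₂ x.1).comp_hasFDerivAt x h1).sub ((hb₂ x.2).comp_hasFDerivAt x h2)
    refine (e1.prodMk e2).congr_fderiv ?_
    ext <;> simp [hF'def, planarMap]
  have hF' : Continuous F' := by
    refine Continuous.congr (f := fun x : ℝ × ℝ => (-a₁' x.1) • planarMap 1 0 0 0 +
      b₁' x.2 • planarMap 0 1 0 0 + a₂' x.1 • planarMap 0 0 1 0 + (-b₂' x.2) • planarMap 0 0 0 1)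
      (by fun_prop) fun x => (planarMap_eq_smul_add _ _ _ _).symm
  have hdet : ∀ x, (F' x).det = a₁' x.1 * b₂' x.2 - a₂' x.1 * b₁' x.2 := by
    intro x; rw [hF'def]; simp only [det_planarMap]; ring
  have hzero : ∀ x, F x = 0 ↔ a₁ x.1 = b₁ x.2 ∧ a₂ x.1 = b₂ x.2 := by
    intro x
    simp only [hFdef, Prod.mk_eq_zero, sub_eq_zero]
    rw [eq_comm (a := b₁ x.2)]
  obtain ⟨ε, hε, h⟩ := exists_forall_setIntegral_comp_mul_det hF hF'
    (K := Icc c (c + T) ×ˢ Icc d (d + T)) (B := Ioc c (c + T) ×ˢ Ioc d (d + T))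
    (isCompact_Icc.prod isCompact_Icc) (prod_mono Ioc_subset_Icc_self Ioc_subset_Icc_self)
    (measurableSet_Ioc.prod measurableSet_Ioc) Z
    (fun x hx h0 => hZ _ hx.1 _ hx.2 ((hzero x).1 h0).1 ((hzero x).1 h0).2)
    (fun x hx => (hzero x).2 (hZ0 x hx))
    (fun x hx => prod_mem_nhds (Ioc_mem_nhds (hZi x hx).1.1 (hZi x hx).1.2)
      (Ioc_mem_nhds (hZi x hx).2.1 (hZi x hx).2.2))
    (fun x hx => by rw [hdet]; exact hreg x hx)
  obtain ⟨Ψ, ψ, ψ', hΨ, hψ, cψ', hs, hi⟩ := exists_smooth_approximate_delta hε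
  have cψ : Continuous ψ := continuous_iff_continuousAt.2 fun x => (hψ x).continuousAt
  have h' := h (fun x => ψ (-x.1) * ψ x.2) (by fun_prop) (by
    intro x hx
    rw [Prod.norm_def, max_lt_iff]
    exact ⟨by simpa using hs _ (left_ne_zero_of_mul hx), hs _ (right_ne_zero_of_mul hx)⟩)
  have hone : ∫ x : ℝ × ℝ, ψ (-x.1) * ψ x.2 = 1 := by
    rw [Measure.volume_eq_prod, integral_prod_mul (fun x => ψ (-x)) ψ, integral_neg_eq_self, hi,
      one_mul]
  simp only [hone, mul_one, hdet] at h'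
  rw [← h']
  have hcont : Continuous fun x : ℝ × ℝ => ψ (-(F x).1) * ψ (F x).2 *
      (a₁' x.1 * b₂' x.2 - a₂' x.1 * b₁' x.2) := by
    have hFc : Continuous F := continuous_iff_continuousAt.2 fun x => (hF x).continuousAt
    fun_prop
  rw [Measure.volume_eq_prod, setIntegral_prod]
  · have := integral_comp_mul_jacobian_eq_zero hΨ hψ cψ' ha₁ ha₂ hb₁ hb₂ ca₁ ca₂ cb₁ cb₂
      pa₁ pa₂ pb₁ pb₂ c d
    simp only [intervalIntegral.integral_of_le (le_add_of_nonneg_right hT)] at this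
    simpa only [hFdef, neg_sub] using this
  · exact (hcont.continuousOn.integrableOn_compact (isCompact_Icc.prod isCompact_Icc)).mono_set
      (prod_mono Ioc_subset_Icc_self Ioc_subset_Icc_self)

/-- A point of `[-ω, 0)` has fractional part at least `1 - ω`. -/
theorem fract_eq_self_of_lt {ω s : ℝ} (hω : 0 < ω) (hs : s ∈ Icc (-ω) (-ω + 1))
    (h : Int.fract s < 1 - ω) : Int.fract s = s := by
  have h0 : 0 ≤ s := by
    by_contra hneg
    push Not at hneg
    have h1 := Int.fract_lt_one s
    have h2 : Int.floor s ≤ -1 := by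
      have : Int.floor s < 0 := Int.floor_lt.2 (by simpa using hneg)
      omega
    have h3 : (Int.floor s : ℝ) ≤ -1 := by exact_mod_cast h2
    have h4 := Int.floor_add_fract s
    linarith [hs.1]
  exact Int.fract_eq_self.2 ⟨h0, by linarith [hs.2]⟩

theorem Function.Periodic.map_fract {f : ℝ → ℝ} (hf : f.Periodic 1) (x : ℝ) :
    f (Int.fract x) = f x := by
  have h := hf.sub_int_mul_eq (x := x) ⌊x⌋
  rwa [mul_one] at h

/-- Two closed plane curves that meet transversely have algebraic intersection number zero. -/
theorem sum_sign_eq_zero {a₁ a₂ b₁ b₂ a₁' a₂' b₁' b₂' : ℝ → ℝ}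
    (ha₁ : ∀ x, HasDerivAt a₁ (a₁' x) x) (ha₂ : ∀ x, HasDerivAt a₂ (a₂' x) x)
    (hb₁ : ∀ x, HasDerivAt b₁ (b₁' x) x) (hb₂ : ∀ x, HasDerivAt b₂ (b₂' x) x)
    (ca₁ : Continuous a₁') (ca₂ : Continuous a₂') (cb₁ : Continuous b₁') (cb₂ : Continuous b₂')
    (pa₁ : a₁.Periodic 1) (pa₂ : a₂.Periodic 1) (pb₁ : b₁.Periodic 1) (pb₂ : b₂.Periodic 1)
    (Z : Finset (ℝ × ℝ))
    (hZ : ∀ s ∈ Ico (0 : ℝ) 1, ∀ t ∈ Ico (0 : ℝ) 1,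
      ((s, t) ∈ Z ↔ a₁ s = b₁ t ∧ a₂ s = b₂ t))
    (hZi : ∀ x ∈ Z, x.1 ∈ Ico (0 : ℝ) 1 ∧ x.2 ∈ Ico (0 : ℝ) 1)
    (hreg : ∀ x ∈ Z, a₁' x.1 * b₂' x.2 - a₂' x.1 * b₁' x.2 ≠ 0) :
    ∑ x ∈ Z, (SignType.sign (a₁' x.1 * b₂' x.2 - a₂' x.1 * b₁' x.2) : ℝ) = 0 := by
  -- Intersections may have a coordinate `0`. Moving the fundamental square back by a small `ω`
  -- makes all of them interior, without letting in translates from near `1`.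
  have hω : ∀ᶠ ω in 𝓝[>] (0 : ℝ), 0 < ω ∧ ∀ x ∈ Z, x.1 < 1 - ω ∧ x.2 < 1 - ω := by
    refine Filter.Eventually.and self_mem_nhdsWithin ((Filter.eventually_all_finset Z).2 fun x hx => ?_)
    refine nhdsWithin_le_nhds (Filter.Eventually.and ?_ ?_)
    · filter_upwards [gt_mem_nhds (sub_pos.2 (hZi x hx).1.2)] with ω h
      linarith
    · filter_upwards [gt_mem_nhds (sub_pos.2 (hZi x hx).2.2)] with ω h
      linarith
  obtain ⟨ω, hω, hlt⟩ := hω.exists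
  refine sum_sign_eq_zero_of_interior zero_le_one ha₁ ha₂ hb₁ hb₂ ca₁ ca₂ cb₁ cb₂ pa₁ pa₂ pb₁ pb₂
    (-ω) (-ω) Z (fun s hs t ht h1 h2 => ?_)
    (fun x hx => (hZ _ (hZi x hx).1 _ (hZi x hx).2).1 hx) (fun x hx => ?_) hreg
  · have hm : (Int.fract s, Int.fract t) ∈ Z :=
      (hZ _ ⟨Int.fract_nonneg _, Int.fract_lt_one _⟩ _ ⟨Int.fract_nonneg _, Int.fract_lt_one _⟩).2
        ⟨by rw [pa₁.map_fract, pb₁.map_fract, h1], by rw [pa₂.map_fract, pb₂.map_fract, h2]⟩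
    have hl := hlt _ hm
    rwa [fract_eq_self_of_lt hω hs hl.1, fract_eq_self_of_lt hω ht hl.2] at hm
  · have h1 := hZi x hx
    have h2 := hlt x hx
    exact ⟨⟨by linarith [h1.1.1], by linarith⟩, ⟨by linarith [h1.2.1], by linarith⟩⟩

/-! ### Linking numbers in a planar projection -/

namespace SpaceLink

variable {n : ℕ}

theorem hasDerivAt_coord (K : SpaceLink n) (i : Fin n) (m : Fin 3) (t : ℝ) :
    HasDerivAt (fun t => K.curve i t m) (deriv (K.curve i) t m) t := by
  have h : HasDerivAt (K.curve i) (deriv (K.curve i) t) t :=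
    ((K.smooth i).differentiable (by simp) t).hasDerivAt
  exact (EuclideanSpace.proj (𝕜 := ℝ) m).hasFDerivAt.comp_hasDerivAt t h

theorem continuous_deriv_coord (K : SpaceLink n) (i : Fin n) (m : Fin 3) :
    Continuous fun t => deriv (K.curve i) t m :=
  (EuclideanSpace.proj (𝕜 := ℝ) m).continuous.comp
    ((K.smooth i).continuous_deriv (by simp))

theorem periodic_coord (K : SpaceLink n) (i : Fin n) (m : Fin 3) :
    Function.Periodic (fun t => K.curve i t m) 1 := fun t => by
  simp only [K.periodic i t]

theorem velocityDet_swap (K : SpaceLink n) (i : Fin n) (s : ℝ) (j : Fin n) (t : ℝ) :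
    K.velocityDet j t i s = -K.velocityDet i s j t := by
  unfold velocityDet; ring

/-- Equal heights would give a common point of two disjoint components. -/
theorem crossesOver_or_of_shadow_eq (K : SpaceLink n) {i j : Fin n} (hij : i ≠ j) {s t : ℝ}
    (h : K.shadow i s = K.shadow j t) : K.CrossesOver i s j t ∨ K.CrossesOver j t i s := by
  rcases lt_trichotomy (K.height j t) (K.height i s) with hlt | heq | hlt
  · exact Or.inl ⟨h, hlt⟩
  · refine absurd (K.embedded i j s t ?_).1 hij
    ext m
    fin_cases m
    · exact congrArg Prod.fst h
    · exact congrArg Prod.snd h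
    · exact heq.symm
  · exact Or.inr ⟨h.symm, hlt⟩

theorem units_eq_sign {ε : ℤˣ} {x : ℝ} (h : 0 < ((ε : ℤ) : ℝ) * x) :
    (SignType.sign x : ℝ) = ((ε : ℤ) : ℝ) := by
  rcases Int.units_eq_one_or ε with rfl | rfl
  · rw [sign_pos (by simpa using h)]; simp
  · rw [sign_neg (by simpa using h)]; simp

theorem HasGaussDiagram.lk_symm {K : SpaceLink n} {D : GaussDiagram n} (hD : K.HasGaussDiagram D)
    {j k : Fin n} (hjk : j ≠ k) : D.lk j k = D.lk k j := by
  classical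
  obtain ⟨pos, hpos, hinj, hcross, -, hsign⟩ := hD
  let S : Fin n → Fin n → Finset D.Arrow := fun j k =>
    Finset.univ.filter fun a => D.comp (D.tail a) = j ∧ D.comp (D.head a) = k
  have hS : ∀ {j k a}, a ∈ S j k ↔ D.comp (D.tail a) = j ∧ D.comp (D.head a) = k := by
    intro j k a; simp [S]
  have hlk : ∀ j k, (D.lk j k : ℝ) = ∑ a ∈ S j k, ((D.sign a : ℤ) : ℝ) := by
    intro j k
    simp only [GaussDiagram.lk, S, Finset.sum_filter]
    push_cast
    exact Finset.sum_congr rfl fun a _ => by split_ifs <;> simp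
  have hover : ∀ {j k a}, a ∈ S j k → K.CrossesOver j (pos (D.tail a)) k (pos (D.head a)) := by
    intro j k a ha
    exact (hcross j k _ (hpos _) _ (hpos _)).2 ⟨a, (hS.1 ha).1, rfl, (hS.1 ha).2, rfl⟩
  -- Both maps put the time on component `j` first: the tail for arrows from `j` to `k`, the head
  -- for arrows from `k` to `j`.
  let u : D.Arrow → ℝ × ℝ := fun a => (pos (D.tail a), pos (D.head a))
  let v : D.Arrow → ℝ × ℝ := fun a => (pos (D.head a), pos (D.tail a))
  have hu : InjOn u (S j k) := fun a ha b hb h =>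
    congrArg Prod.fst (hinj (D.tail a) (D.tail b)
      ((hS.1 ha).1.trans (hS.1 hb).1.symm) (congrArg Prod.fst h))
  have hv : InjOn v (S k j) := fun a ha b hb h =>
    congrArg Prod.fst (hinj (D.tail a) (D.tail b)
      ((hS.1 ha).1.trans (hS.1 hb).1.symm) (congrArg Prod.snd h))
  have hd : Disjoint ((S j k).image u) ((S k j).image v) := by
    rw [Finset.disjoint_left]
    intro x hx hx'
    obtain ⟨a, ha, rfl⟩ := Finset.mem_image.1 hx
    obtain ⟨b, hb, h⟩ := Finset.mem_image.1 hx'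
    have h1 := (hover ha).2
    have h2 := (hover hb).2
    rw [show pos (D.tail b) = pos (D.head a) from congrArg Prod.snd h,
      show pos (D.head b) = pos (D.tail a) from congrArg Prod.fst h] at h2
    exact lt_asymm h1 h2
  have hdetu : ∀ a ∈ S j k,
      (SignType.sign (K.velocityDet j (u a).1 k (u a).2) : ℝ) = ((D.sign a : ℤ) : ℝ) := by
    intro a ha
    have := hsign a
    rw [(hS.1 ha).1, (hS.1 ha).2] at this
    exact units_eq_sign this
  have hdetv : ∀ a ∈ S k j,
      (SignType.sign (K.velocityDet j (v a).1 k (v a).2) : ℝ) = -((D.sign a : ℤ) : ℝ) := by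
    intro a ha
    have := hsign a
    rw [(hS.1 ha).1, (hS.1 ha).2] at this
    rw [velocityDet_swap, Left.sign_neg]
    simp only [SignType.coe_neg, neg_inj]
    exact units_eq_sign this
  have hne : ∀ ε : ℤˣ, ((ε : ℤ) : ℝ) ≠ 0 := fun ε => by exact_mod_cast ε.ne_zero
  have key := sum_sign_eq_zero (K.hasDerivAt_coord j 0) (K.hasDerivAt_coord j 1)
    (K.hasDerivAt_coord k 0) (K.hasDerivAt_coord k 1) (K.continuous_deriv_coord j 0)
    (K.continuous_deriv_coord j 1) (K.continuous_deriv_coord k 0) (K.continuous_deriv_coord k 1)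
    (K.periodic_coord j 0) (K.periodic_coord j 1) (K.periodic_coord k 0) (K.periodic_coord k 1)
    ((S j k).image u ∪ (S k j).image v) ?_ ?_ ?_
  · change ∑ x ∈ (S j k).image u ∪ (S k j).image v,
      (SignType.sign (K.velocityDet j x.1 k x.2) : ℝ) = 0 at key
    rw [Finset.sum_union hd, Finset.sum_image hu, Finset.sum_image hv,
      Finset.sum_congr rfl hdetu, Finset.sum_congr rfl hdetv, Finset.sum_neg_distrib,
      ← hlk, ← hlk] at key
    have : (D.lk j k : ℝ) = D.lk k j := by linarith
    exact_mod_cast this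
  · intro s hs t ht
    rw [Finset.mem_union, Finset.mem_image, Finset.mem_image]
    constructor
    · rintro (⟨a, ha, h⟩ | ⟨a, ha, h⟩)
      · obtain ⟨rfl, rfl⟩ := Prod.mk.inj h
        exact Prod.mk.inj (hover ha).1
      · obtain ⟨rfl, rfl⟩ := Prod.mk.inj h
        exact Prod.mk.inj (hover ha).1.symm
    · rintro ⟨h1, h2⟩
      rcases K.crossesOver_or_of_shadow_eq hjk (Prod.ext h1 h2) with h | h
      · obtain ⟨a, ha, rfl, ha', rfl⟩ := (hcross j k s hs t ht).1 h
        exact Or.inl ⟨a, hS.2 ⟨ha, ha'⟩, rfl⟩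
      · obtain ⟨a, ha, rfl, ha', rfl⟩ := (hcross k j t ht s hs).1 h
        exact Or.inr ⟨a, hS.2 ⟨ha, ha'⟩, rfl⟩
  · intro x hx
    rcases Finset.mem_union.1 hx with hx | hx <;> obtain ⟨a, -, rfl⟩ := Finset.mem_image.1 hx <;>
      exact ⟨hpos _, hpos _⟩
  -- Transversality follows from the sign condition: the sign of the determinant is `±1`.
  · intro x hx h0
    change K.velocityDet j x.1 k x.2 = 0 at h0
    rcases Finset.mem_union.1 hx with hx | hx <;> obtain ⟨a, ha, rfl⟩ := Finset.mem_image.1 hx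
    · have := hdetu a ha
      rw [h0] at this
      exact hne (D.sign a) (by rw [← this, sign_zero, SignType.coe_zero])
    · have := hdetv a ha
      rw [h0] at this
      exact hne (D.sign a) (neg_eq_zero.1 (by rw [← this, sign_zero, SignType.coe_zero]))

end SpaceLink

end PlaneCurves

theorem GaussDiagram.IsClassical.lk_symm {n : ℕ} {D : GaussDiagram n} (hD : D.IsClassical)
    (j k : Fin n) : D.lk j k = D.lk k j := by
  obtain ⟨K, D₀, -, hK, hR⟩ := hD
  by_cases hjk : j = k
  · rw [hjk]
  · rw [hR.lk_eq hjk, hR.lk_eq (Ne.symm hjk), hK.lk_symm hjk]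

theorem mainTheorem3 (n : ℕ) (D : GaussDiagram n) (hD : D.IsClassical) :
    (∀ j k : Fin n, D.lk j k = D.lk k j) ∧
      (∃! M : Matrix (Fin n) (Fin n) ℤ, D.IsForbiddenMatrix M) ∧
      (∀ M : Matrix (Fin n) (Fin n) ℤ, D.IsForbiddenMatrix M → M.IsSymm) :=
  ⟨hD.lk_symm, D.existsUnique_isForbiddenMatrix, fun _ hM => hM.isSymm hD.lk_symm⟩
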